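/- A \emph{word} is a finite (possibly empty) string of positive integers. Define maps $\mathsf{fast}$ and $\mathsf{slow}$ from words to words recursively by $\mathsf{fast}(\varepsilon)=\mathsf{slow}(\varepsilon)=\varepsilon$ for the empty word $\varepsilon$ and, for a nonempty word $w=A_1nA_2n\cdots nA_{k+1}$, where $n$ is the largest letter of $w$, occurring exactly $k$ times, by $$\mathsf{fast}(w)=\mathsf{fast}(A_1)\mathsf{fast}(A_2)\cdots\mathsf{fast}(A_{k+1})\underbrace{n\cdots n}_{k},\qquad \mathsf{slow}(w)=\mathsf{slow}(A_1)\,\mathsf{slow}(A_2)\,n\,\mathsf{slow}(A_3)\,n\cdots\mathsf{slow}(A_{k+1})\,n .$$ Let $w=w_1\cdots w_m$ be a word. A \emph{hook} of $w$ is given by two points $(i,w_i)$, $(j,w_j)$ with $i<j$ and $w_i\le w_j$, called its southwest and northeast endpoints; it is drawn as the vertical segment from $(i,w_i)$ to $(i,w_j)$ followed by the horizontal segment from $(i,w_j)$ to $(j,w_j)$. It is \emph{horizontal} if $w_i=w_j$, \emph{small} if $j=i+1$, and a \emph{descent hook} if $i$ is a \emph{descent} of $w$, that is, $i\le m-1$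 and $w_i\ge w_{i+1}$. A \emph{valid hook configuration} of $w$ is a tuple $\mathscr H=(H_1,\ldots,H_k)$, $k\ge 0$, of hooks of $w$, where $H_u$ has endpoints $(i_u,w_{i_u})$ and $(j_u,w_{j_u})$, such that 1. $i_1<\cdots<i_k$; 2. for every descent $d$ of $w$, the point $(d,w_d)$ is the southwest endpoint of some $H_u$; 3. every northeast endpoint of a hook of $\mathscr H$ is the northeast endpoint of a descent hook of $\mathscr H$ and of a small hook of $\mathscr H$ (possibly the same hook); 4. for all $u,v$, the real open intervals $(i_u,j_u)$ and $(i_v,j_v)$ are disjoint or one contains the other. It is \emph{binary} if every point is the northeast endpoint of at most two hooks of $\mathscr H$. For each point $(i,w_i)$ consider the hooks $H_u$ for which either $j_u=i$, or $i_u<i<j_u$ and $w_i\le w_{j_u}$. If there are none, the point is colored by the sky; otherwise it receives the color of the one among these hooks with the rightmost southwest endpoint. Let $q^{\mathscr H}=(q_0,q_1,\ldots,q_k)$, where $q_0$ is the number of points colored by the sky and $q_r$ is the number of points with the color of $H_r$ for $1\le r\le k$. For $q=(q_0,\ldots,q_k)$ put $C_q=\prod_{t=0}^{k}C_{q_t}$,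 where $C_n=\frac{1}{n+1}\binom{2n}{n}$. Let $\mathcal H_{\mathcal R}(w)$ be the set of binary valid hook configurations of $w$ in which every horizontal hook is small, and let $\mathcal H_{\mathcal L}(w)$ be the set of binary valid hook configurations of $w$ in which no small horizontal hook has the same northeast endpoint as another hook of the configuration. Then for every word $w$ the sets $\mathsf{fast}^{-1}(w)$ and $\mathsf{slow}^{-1}(w)$ are finite and $$|\mathsf{fast}^{-1}(w)|=\sum_{\mathscr H\in\mathcal H_{\mathcal R}(w)}C_{q^{\mathscr H}},\qquad |\mathsf{slow}^{-1}(w)|=\sum_{\mathscr H\in\mathcal H_{\mathcal L}(w)}C_{q^{\mathscr H}} .$$ -/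

import Mathlib

namespace StackSortWords

/-- Words: finite strings over the alphabet of positive integers. -/
abbrev Word : Type := List ℕ+

theorem length_le_of_mem_splitOn {w A : Word} {n : ℕ+}
    (hA : A ∈ w.splitOn n) : A.length ≤ w.length := by
  induction w generalizing A with
  | nil => simp_all
  | cons x t ih =>
    rw [List.splitOn_cons_eq_if_modifyHead] at hA
    split_ifs at hA with hx
    · rcases List.mem_cons.1 hA with rfl | hA
      · simp
      · exact (ih hA).trans (by simp)
    · cases hs : t.splitOn n with
      | nil => simp at hs
      | cons B S =>
        rw [hs] at hA ih
        rcases List.mem_cons.1 hA with rfl | hA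
        · simpa using ih (List.mem_cons_self)
        · exact (ih (List.mem_cons_of_mem _ hA)).trans (by simp)

theorem length_lt_of_mem_splitOn {w A : Word} {n : ℕ+} (hn : n ∈ w)
    (hA : A ∈ w.splitOn n) : A.length < w.length := by
  obtain ⟨s, t, rfl⟩ := List.append_of_mem hn
  rw [List.splitOn_append_cons_self, List.mem_append] at hA
  simp only [List.length_append, List.length_cons]
  rcases hA with hA | hA <;> have := length_le_of_mem_splitOn hA <;> omega

/-- If `w` is nonempty with largest letter `n` and `w = A₁ n A₂ n ⋯ n Aₖ₊₁` (no `n` in any `Aᵢ`),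
then `fast w = fast A₁ ⋯ fast Aₖ₊₁ n ⋯ n` with `k` copies of `n` at the end. -/
def fast (w : Word) : Word :=
  if h : w = [] then []
  else
    ((w.splitOn (w.max h)).attach.flatMap fun A => fast A.1) ++
      List.replicate (w.count (w.max h)) (w.max h)
termination_by w.length
decreasing_by exact length_lt_of_mem_splitOn (List.max_mem h) A.2

/-- If `w` is nonempty with largest letter `n` and `w = A₁ n A₂ n ⋯ n Aₖ₊₁` (no `n` in any `Aᵢ`),
then `slow w = (slow A₁) (slow A₂) n (slow A₃) n ⋯ (slow Aₖ₊₁) n`. -/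
def slow (w : Word) : Word :=
  if h : w = [] then []
  else
    (((w.splitOn (w.max h)).attach.take 1).flatMap fun A => slow A.1) ++
      (((w.splitOn (w.max h)).attach.drop 1).flatMap fun A => slow A.1 ++ [w.max h])
termination_by w.length
decreasing_by all_goals exact length_lt_of_mem_splitOn (List.max_mem h) A.2

theorem fast_nil : fast [] = [] := by
  rw [fast]; simp

theorem slow_nil : slow [] = [] := by
  rw [slow]; simp

theorem fast_of_ne_nil {w : Word} (h : w ≠ []) :
    fast w = (w.splitOn (w.max h)).flatMap fast ++
      List.replicate (w.count (w.max h)) (w.max h) := by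
  rw [fast, dif_neg h]
  congr 1
  conv_rhs => rw [← List.attach_map_subtype_val (w.splitOn (w.max h))]
  rw [List.flatMap_map]

theorem slow_of_ne_nil {w : Word} (h : w ≠ []) :
    slow w = ((w.splitOn (w.max h)).take 1).flatMap slow ++
      ((w.splitOn (w.max h)).drop 1).flatMap fun A => slow A ++ [w.max h] := by
  rw [slow, dif_neg h]
  conv_rhs => rw [← List.attach_map_subtype_val (w.splitOn (w.max h))]
  rw [← List.map_take, ← List.map_drop, List.flatMap_map, List.flatMap_map]

/-- A hook of `w`, given by the positions of its southwest endpoint `(sw, w[sw])` and its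
northeast endpoint `(ne, w[ne])` in the plot of `w` (positions are counted from `0`). -/
@[ext]
structure Hook (w : Word) where
  sw : Fin w.length
  ne : Fin w.length
  sw_lt_ne : sw < ne
  letter_le : w[sw] ≤ w[ne]

/-- `d` is a descent of `w`: `d + 1` is also a position and `w_d ≥ w_{d+1}`. -/
def IsDescent (w : Word) (d : Fin w.length) : Prop :=
  ∃ h : (d : ℕ) + 1 < w.length, w[(d : ℕ) + 1] ≤ w[d]

namespace Hook

variable {w : Word}

instance : Finite (Hook w) :=
  Finite.of_injective (fun H : Hook w => (H.sw, H.ne)) fun H K h => by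
    simp only [Prod.mk.injEq] at h
    exact Hook.ext h.1 h.2

/-- The southwest endpoint is a descent top. -/
def IsDescentHook (H : Hook w) : Prop := IsDescent w H.sw

/-- Both endpoints have the same height. -/
def IsHorizontal (H : Hook w) : Prop := w[H.sw] = w[H.ne]

/-- The endpoints are in adjacent positions. -/
def IsSmall (H : Hook w) : Prop := (H.ne : ℕ) = H.sw + 1

/-- The hook lies (weakly) above the point `(i, w[i])`; the endpoints of a hook do not lie
below it. -/
def LiesAbove (H : Hook w) (i : Fin w.length) : Prop :=
  H.sw < i ∧ i < H.ne ∧ w[i] ≤ w[H.ne]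

end Hook

/-- Tuples `(H₁, …, Hₖ)` of hooks of `w`, of any length `k ≥ 0`. -/
abbrev HookTuple (w : Word) : Type := Σ k : ℕ, Fin k → Hook w

namespace HookTuple

variable {w : Word}

/-- Valid hook configurations. In `nested`, the first two alternatives say that the (real) open
intervals `(i_u, j_u)` and `(i_v, j_v)` are disjoint, the last two that one contains the other. -/
structure IsValid (H : HookTuple w) : Prop where
  sw_strictMono : StrictMono fun u => (H.2 u).sw
  descent : ∀ d, IsDescent w d → ∃ u, (H.2 u).sw = d
  northeast : ∀ u, (∃ v, (H.2 v).ne = (H.2 u).ne ∧ (H.2 v).IsDescentHook) ∧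
    ∃ v, (H.2 v).ne = (H.2 u).ne ∧ (H.2 v).IsSmall
  nested : ∀ u v,
    ((H.2 u).ne ≤ (H.2 v).sw ∨ (H.2 v).ne ≤ (H.2 u).sw) ∨
    ((H.2 u).sw ≤ (H.2 v).sw ∧ (H.2 v).ne ≤ (H.2 u).ne) ∨
    ((H.2 v).sw ≤ (H.2 u).sw ∧ (H.2 u).ne ≤ (H.2 v).ne)

/-- Every point is the northeast endpoint of at most two hooks. -/
def IsBinary (H : HookTuple w) : Prop :=
  ∀ j : Fin w.length, {u | (H.2 u).ne = j}.ncard ≤ 2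

/-- The point at position `i` sees the hook `H_u` when looking up: the hook lies above the point
or has it as its northeast endpoint. -/
def Sees (H : HookTuple w) (i : Fin w.length) (u : Fin H.1) : Prop :=
  (H.2 u).LiesAbove i ∨ (H.2 u).ne = i

/-- The point at position `i` receives the color of the sky. -/
def HasSkyColor (H : HookTuple w) (i : Fin w.length) : Prop :=
  ∀ u, ¬ H.Sees i u

/-- The point at position `i` receives the color of `H_u`: among the hooks it sees, `H_u` is the
one with the rightmost southwest endpoint. -/
def HasColor (H : HookTuple w) (i : Fin w.length) (u : Fin H.1) : Prop :=
  H.Sees i u ∧ ∀ v, H.Sees i v → (H.2 v).sw ≤ (H.2 u).sw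

/-- The induced composition `(q₀, q₁, …, qₖ)`: `q₀` counts the points with the color of the sky,
and `q_r` for `r ≥ 1` those with the color of the `r`-th hook. -/
noncomputable def q (H : HookTuple w) : Fin (H.1 + 1) → ℕ :=
  Fin.cons {i | H.HasSkyColor i}.ncard fun u => {i | H.HasColor i u}.ncard

theorem finite_isValid (w : Word) : {H : HookTuple w | H.IsValid}.Finite := by
  have hfin : (Set.range fun x : Σ k : Fin (w.length + 1), (Fin k → Hook w) =>
      (⟨x.1, x.2⟩ : HookTuple w)).Finite := Set.finite_range _
  refine hfin.subset ?_
  rintro ⟨k, H⟩ hH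
  have hk : k ≤ w.length := by
    simpa using Fintype.card_le_of_injective _ hH.sw_strictMono.injective
  exact ⟨⟨⟨k, Nat.lt_succ_of_le hk⟩, H⟩, rfl⟩

end HookTuple

/-- `C_q = C_{q₀} ⋯ C_{qₖ}`, a product of Catalan numbers. -/
def catalanProd {k : ℕ} (q : Fin k → ℕ) : ℕ := ∏ t, catalan (q t)

/-- The binary valid hook configurations of `w` in which every horizontal hook is small. -/
noncomputable def hooksR (w : Word) : Finset (HookTuple w) :=
  ((HookTuple.finite_isValid w).subset (Set.sep_subset _ fun H =>
    H.IsBinary ∧ ∀ u, (H.2 u).IsHorizontal → (H.2 u).IsSmall)).toFinset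

/-- The binary valid hook configurations of `w` in which no small horizontal hook has the same
northeast endpoint as another hook. -/
noncomputable def hooksL (w : Word) : Finset (HookTuple w) :=
  ((HookTuple.finite_isValid w).subset (Set.sep_subset _ fun H =>
    H.IsBinary ∧ ∀ u, (H.2 u).IsSmall → (H.2 u).IsHorizontal →
      ∀ v, v ≠ u → (H.2 v).ne ≠ (H.2 u).ne)).toFinset

theorem mem_hooksR {w : Word} {H : HookTuple w} :
    H ∈ hooksR w ↔ H.IsValid ∧ H.IsBinary ∧
      ∀ u, (H.2 u).IsHorizontal → (H.2 u).IsSmall := by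
  simp [hooksR]

theorem mem_hooksL {w : Word} {H : HookTuple w} :
    H ∈ hooksL w ↔ H.IsValid ∧ H.IsBinary ∧
      ∀ u, (H.2 u).IsSmall → (H.2 u).IsHorizontal →
        ∀ v, v ≠ u → (H.2 v).ne ≠ (H.2 u).ne := by
  simp [hooksL]

end StackSortWords

/-!
Write a word as `A n B` with `n` its largest letter, choosing the first or the last occurrence.
Then `fast` (first) and `slow` (last) send `A n B` to the image of `A`, the image of `B` and `n`,
that is, they read the resulting decreasing binary tree in postorder. A preimage of a word whose
last letter is `n` is therefore given by cutting the rest of the word in two and choosing a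
preimage of each part, subject to the comparisons of the two parts with `n`. This yields a
recurrence for the numbers of preimages of the intervals of a fixed word, quadratic in them.

Hook configurations are decomposed at their last point. If no hook ends there, removing the point
removes one point colored by the sky. Otherwise the leftmost hook ending there separates two
configurations, and the sky of the right one takes the color of this hook. To compare the two
recurrences, write the Catalan number of the sky as `C_{q+1} = ∑ C_i C_{q-i}` and cut the
configuration at the start of the last `q - i` points of the sky: the two pieces are again
independent configurations, and these cuts together with the leftmost hooks ending at the last
point run through the cuts that occur for the preimages.
-/

namespace StackSortWords

open Finset

section TieRule

/-- A relation between `<` and `≤`, deciding on which side of a root equal letters are placed. In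
a word `A n B` with root `n` the letters of `A` satisfy `p · n` and those of `B` satisfy `¬ p n ·`,
so `<` puts the letters equal to `n` into `B` and `≤` puts them into `A`. -/
structure IsTieRule {α : Type*} [Preorder α] (p : α → α → Prop) : Prop where
  of_lt : ∀ {x y : α}, x < y → p x y
  le : ∀ {x y : α}, p x y → x ≤ y

theorem isTieRule_lt {α : Type*} [Preorder α] : IsTieRule ((· < ·) : α → α → Prop) :=
  ⟨id, le_of_lt⟩

theorem isTieRule_le {α : Type*} [Preorder α] : IsTieRule ((· ≤ ·) : α → α → Prop) :=
  ⟨le_of_lt, id⟩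

namespace IsTieRule

theorem of_le_of_rel {α : Type*} [PartialOrder α] {p : α → α → Prop} (hp : IsTieRule p)
    {x y z : α} (hxy : x ≤ y) (hyz : p y z) : p x z :=
  hxy.eq_or_lt.elim (fun h => h ▸ hyz) fun h => hp.of_lt (h.trans_le (hp.le hyz))

theorem of_rel_of_le {α : Type*} [PartialOrder α] {p : α → α → Prop} (hp : IsTieRule p)
    {x y z : α} (hxy : p x y) (hyz : y ≤ z) : p x z :=
  hyz.eq_or_lt.elim (fun h => h ▸ hxy) fun h => hp.of_lt ((hp.le hxy).trans_lt h)

theorem le_of_not_rel {α : Type*} [LinearOrder α] {p : α → α → Prop} (hp : IsTieRule p) {x y : α}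
    (h : ¬ p x y) : y ≤ x :=
  not_lt.1 fun hlt => h (hp.of_lt hlt)

end IsTieRule

end TieRule

section HookConfig

variable {α : Type*} [LinearOrder α] {p : α → α → Prop} {f : ℕ → α} {l l' r r' c : ℕ}
  {S A B : Finset (ℕ × ℕ)}

/-- Binary valid hook configurations on the positions `[l, r)` of the sequence of letters `f`, a
hook being encoded as the pair of the positions of its southwest and northeast endpoints. The tie
rule `p` restricts the letters at `s`, `e - 1` and `e` for each hook `(s, e)` that is not small. -/
structure IsHookConfig (p : α → α → Prop) (f : ℕ → α) (l r : ℕ) (S : Finset (ℕ × ℕ)) :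
    Prop where
  bounds : ∀ {s e}, (s, e) ∈ S → l ≤ s ∧ s < e ∧ e < r
  letter_le : ∀ {s e}, (s, e) ∈ S → f s ≤ f e
  ne_unique : ∀ {s e e'}, (s, e) ∈ S → (s, e') ∈ S → e = e'
  exists_of_descent : ∀ {d}, l ≤ d → d + 1 < r → f (d + 1) ≤ f d → ∃ e, (d, e) ∈ S
  small_mem : ∀ {s e}, (s, e) ∈ S → (e - 1, e) ∈ S
  exists_descent : ∀ {s e}, (s, e) ∈ S → ∃ d, (d, e) ∈ S ∧ f (d + 1) ≤ f d
  nested : ∀ {s e s' e'}, (s, e) ∈ S → (s', e') ∈ S → s < s' → e ≤ s' ∨ e' ≤ e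
  binary : ∀ {s s' e}, (s, e) ∈ S → (s', e) ∈ S → s + 1 < e → s' + 1 < e → s = s'
  tie : ∀ {s e}, (s, e) ∈ S → s + 1 < e → p (f s) (f e) ∧ ¬ p (f e) (f (e - 1))

/-- The hooks of `S` with both endpoints in `[l, r)`. -/
def hooksWithin (S : Finset (ℕ × ℕ)) (l r : ℕ) : Finset (ℕ × ℕ) :=
  {h ∈ S | l ≤ h.1 ∧ h.2 < r}

theorem mem_hooksWithin {s e : ℕ} :
    (s, e) ∈ hooksWithin S l r ↔ (s, e) ∈ S ∧ l ≤ s ∧ e < r := by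
  simp [hooksWithin]

/-- The configuration on `[l, r]` whose last point `r` is the northeast endpoint of hooks from
`c - 1` and from `r - 1`, with `A` the part on `[l, c)` and `B` the part on `[c, r)`. For `c = r`
the two hooks coincide and `B` is empty. -/
def joinHooks (c r : ℕ) (A B : Finset (ℕ × ℕ)) : Finset (ℕ × ℕ) :=
  insert (r - 1, r) (insert (c - 1, r) (A ∪ B))

theorem mem_joinHooks {s e : ℕ} : (s, e) ∈ joinHooks c r A B ↔
    (s = r - 1 ∧ e = r) ∨ (s = c - 1 ∧ e = r) ∨ (s, e) ∈ A ∨ (s, e) ∈ B := by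
  simp [joinHooks]

/-- The letters of `f` admit hooks from `c - 1` and from `r - 1` to `r` in a configuration. -/
def Joinable (p : α → α → Prop) (f : ℕ → α) (c r : ℕ) : Prop :=
  f (c - 1) ≤ f r ∧ f (r - 1) ≤ f r ∧ (f c ≤ f (c - 1) ∨ f r ≤ f (r - 1)) ∧
    (c < r → p (f (c - 1)) (f r) ∧ ¬ p (f r) (f (r - 1)))

namespace IsHookConfig

theorem restrict (hS : IsHookConfig p f l r S) (hl : l ≤ l') (hr : r' ≤ r)
    (no_enter : ∀ {s e}, (s, e) ∈ S → l' < e → e < r' → l' ≤ s)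
    (no_exit : ∀ {s e}, (s, e) ∈ S → l' ≤ s → s + 1 < r' → e < r') :
    IsHookConfig p f l' r' (hooksWithin S l' r') := by
  constructor <;> simp only [mem_hooksWithin]
  case bounds => exact fun h => ⟨h.2.1, (hS.bounds h.1).2.1, h.2.2⟩
  case letter_le => exact fun h => hS.letter_le h.1
  case ne_unique => exact fun h h' => hS.ne_unique h.1 h'.1
  case exists_of_descent =>
    intro d hd hd' hdesc
    obtain ⟨e, he⟩ := hS.exists_of_descent (hl.trans hd) (hd'.trans_le hr) hdesc
    exact ⟨e, he, hd, no_exit he hd hd'⟩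
  case small_mem =>
    exact fun h => ⟨hS.small_mem h.1, by grind [hS.bounds h.1], h.2.2⟩
  case exists_descent =>
    intro s e h
    obtain ⟨d, hd, hdesc⟩ := hS.exists_descent h.1
    exact ⟨d, ⟨hd, no_enter hd (h.2.1.trans_lt (hS.bounds h.1).2.1) h.2.2, h.2.2⟩, hdesc⟩
  case nested => exact fun h h' => hS.nested h.1 h'.1
  case binary => exact fun h h' => hS.binary h.1 h'.1
  case tie => exact fun h => hS.tie h.1

theorem eq_empty (hS : IsHookConfig p f l l S) : S = ∅ := by
  refine eq_empty_of_forall_notMem fun h hh => ?_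
  have := hS.bounds hh
  omega

theorem empty (p : α → α → Prop) (f : ℕ → α) (l : ℕ) : IsHookConfig p f l l ∅ := by
  constructor <;> simp
  omega

theorem notMem_of_le (hS : IsHookConfig p f l r S) {s e : ℕ} (he : r ≤ e) : (s, e) ∉ S :=
  fun h => he.not_gt (hS.bounds h).2.2

theorem extend (hS : IsHookConfig p f l r S) (hr : l < r → f (r - 1) < f r) :
    IsHookConfig p f l (r + 1) S where
  bounds h := by grind [hS.bounds h]
  letter_le := hS.letter_le
  ne_unique := hS.ne_unique
  exists_of_descent {d} hld hdr hdesc := by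
    rcases Nat.lt_succ_iff_lt_or_eq.1 hdr with hdr | rfl
    · exact hS.exists_of_descent hld hdr hdesc
    · exact absurd hdesc (hr (by omega)).not_ge
  small_mem := hS.small_mem
  exists_descent := hS.exists_descent
  nested := hS.nested
  binary := hS.binary
  tie := hS.tie

theorem of_succ (hS : IsHookConfig p f l (r + 1) S) (hr : ∀ s, (s, r) ∉ S) :
    IsHookConfig p f l r S := by
  have ne_lt {s e} (h : (s, e) ∈ S) : e < r :=
    (Nat.le_of_lt_succ (hS.bounds h).2.2).lt_of_ne fun he => hr s (he ▸ h)
  have within : hooksWithin S l r = S :=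
    filter_true_of_mem fun _ h => ⟨(hS.bounds h).1, ne_lt h⟩
  rw [← within]
  exact hS.restrict le_rfl r.le_succ (fun h _ _ => (hS.bounds h).1) fun h _ _ => ne_lt h

theorem letter_lt_of_forall_notMem (hS : IsHookConfig p f l (r + 1) S) (hr : ∀ s, (s, r) ∉ S)
    (hlr : l < r) : f (r - 1) < f r := by
  by_contra! hdesc
  obtain ⟨e, he⟩ := hS.exists_of_descent (d := r - 1) (by omega) (by omega)
    (by rwa [Nat.sub_add_cancel (by omega)])
  have : e = r := by grind [hS.bounds he]
  exact hr _ (this ▸ he)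

theorem join_nested (hA : IsHookConfig p f l c A) (hB : IsHookConfig p f c r B)
    (hcr : c ≤ r) {s e s' e' : ℕ} (h : (s, e) ∈ joinHooks c r A B)
    (h' : (s', e') ∈ joinHooks c r A B) (hlt : s < s') : e ≤ s' ∨ e' ≤ e := by
  rw [mem_joinHooks] at h h'
  rcases h with ⟨rfl, rfl⟩ | ⟨rfl, rfl⟩ | h | h <;> rcases h' with ⟨rfl, rfl⟩ | ⟨rfl, rfl⟩ | h' | h'
  case inr.inr.inl.inr.inr.inl => exact hA.nested h h' hlt
  case inr.inr.inr.inr.inr.inr => exact hB.nested h h' hlt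
  all_goals grind [→ bounds]

theorem join_exists_of_descent (hA : IsHookConfig p f l c A) (hB : IsHookConfig p f c r B)
    {d : ℕ} (hld : l ≤ d) (hdr : d + 1 < r + 1)
    (hdesc : f (d + 1) ≤ f d) : ∃ e, (d, e) ∈ joinHooks c r A B := by
  simp only [mem_joinHooks]
  rcases lt_trichotomy (d + 1) c with hdc | hdc | hdc
  · obtain ⟨e, he⟩ := hA.exists_of_descent hld hdc hdesc
    exact ⟨e, by tauto⟩
  · exact ⟨r, by omega⟩
  · rcases Nat.lt_succ_iff_lt_or_eq.1 hdr with hdr | hdr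
    · obtain ⟨e, he⟩ := hB.exists_of_descent (Nat.le_of_lt_succ hdc) hdr hdesc
      exact ⟨e, by tauto⟩
    · exact ⟨r, by omega⟩

theorem join_exists_descent (hA : IsHookConfig p f l c A) (hB : IsHookConfig p f c r B)
    (hlc : l < c) (hcr : c ≤ r) (hJ : Joinable p f c r) {s e : ℕ}
    (h : (s, e) ∈ joinHooks c r A B) : ∃ d, (d, e) ∈ joinHooks c r A B ∧ f (d + 1) ≤ f d := by
  have at_last : ∃ d, (d, r) ∈ joinHooks c r A B ∧ f (d + 1) ≤ f d := by
    rcases hJ.2.2.1 with hdesc | hdesc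
    · exact ⟨c - 1, by simp [mem_joinHooks], by rwa [Nat.sub_add_cancel (by omega)]⟩
    · exact ⟨r - 1, by simp [mem_joinHooks], by rwa [Nat.sub_add_cancel (by omega)]⟩
  rw [mem_joinHooks] at h
  rcases h with ⟨-, rfl⟩ | ⟨-, rfl⟩ | h | h
  · exact at_last
  · exact at_last
  · obtain ⟨d, hd, hdesc⟩ := hA.exists_descent h
    exact ⟨d, mem_joinHooks.2 (by tauto), hdesc⟩
  · obtain ⟨d, hd, hdesc⟩ := hB.exists_descent h
    exact ⟨d, mem_joinHooks.2 (by tauto), hdesc⟩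

theorem join (hA : IsHookConfig p f l c A) (hB : IsHookConfig p f c r B) (hlc : l < c)
    (hcr : c ≤ r) (hJ : Joinable p f c r) : IsHookConfig p f l (r + 1) (joinHooks c r A B) where
  bounds h := by grind [mem_joinHooks, → bounds, Nat.le_sub_one_of_lt hlc]
  letter_le h := by grind [mem_joinHooks, → letter_le, Joinable]
  ne_unique h h' := by grind [mem_joinHooks, → bounds, → ne_unique]
  exists_of_descent := join_exists_of_descent hA hB
  small_mem h := by grind [mem_joinHooks, → small_mem]
  exists_descent := join_exists_descent hA hB hlc hcr hJ
  nested := join_nested hA hB hcr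
  binary h h' _ _ := by grind [mem_joinHooks, → bounds, → binary]
  tie h _ := by grind [mem_joinHooks, → tie, Joinable]

theorem mem_cases (hS : IsHookConfig p f l (r + 1) S) (hc : IsLeast {s | (s, r) ∈ S} (c - 1))
    {s e : ℕ} (h : (s, e) ∈ S) :
    (s = c - 1 ∧ e = r) ∨ (s = r - 1 ∧ e = r) ∨ e < c ∨ (c ≤ s ∧ e < r) := by
  have hmem : (c - 1, r) ∈ S := hc.1
  have hsr := hS.bounds h
  have hcr := hS.bounds hmem
  rcases lt_trichotomy s (c - 1) with hs | rfl | hs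
  · have : ¬ (s, r) ∈ S := fun hr => hs.not_ge (hc.2 hr)
    rcases hS.nested h hmem hs with he | he
    · omega
    · exact absurd (le_antisymm (by omega) he ▸ h) this
  · exact .inl ⟨rfl, hS.ne_unique h hmem⟩
  · rcases hS.nested hmem h hs with he | he
    · omega
    · rcases he.eq_or_lt with rfl | he
      · by_contra! hne
        have := hS.binary hmem h (by omega) (by omega)
        omega
      · omega

theorem restrict_left (hS : IsHookConfig p f l (r + 1) S)
    (hc : IsLeast {s | (s, r) ∈ S} (c - 1)) : IsHookConfig p f l c (hooksWithin S l c) := by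
  have := hS.bounds hc.1
  refine hS.restrict le_rfl (by omega) (fun h _ _ => (hS.bounds h).1) fun h _ _ => ?_
  grind [hS.mem_cases hc h]

theorem restrict_right (hS : IsHookConfig p f l (r + 1) S) (hlc : l < c)
    (hc : IsLeast {s | (s, r) ∈ S} (c - 1)) : IsHookConfig p f c r (hooksWithin S c r) := by
  refine hS.restrict hlc.le r.le_succ (fun h _ _ => ?_) fun h _ _ => ?_ <;>
    grind [hS.mem_cases hc h, hS.bounds h]

theorem joinable (hS : IsHookConfig p f l (r + 1) S) (hlc : l < c)
    (hc : IsLeast {s | (s, r) ∈ S} (c - 1)) : Joinable p f c r := by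
  have hmem : (c - 1, r) ∈ S := hc.1
  have hcr := hS.bounds hmem
  refine ⟨hS.letter_le hmem, hS.letter_le (hS.small_mem hmem), ?_,
    fun hlt => hS.tie hmem (by omega)⟩
  obtain ⟨d, hd, hdesc⟩ := hS.exists_descent hmem
  rcases hS.mem_cases hc hd with ⟨rfl, -⟩ | ⟨rfl, -⟩ | hd | hd
  · exact .inl (by rwa [Nat.sub_add_cancel (by omega)] at hdesc)
  · exact .inr (by rwa [Nat.sub_add_cancel (by omega)] at hdesc)
  all_goals omega

theorem joinHooks_hooksWithin (hS : IsHookConfig p f l (r + 1) S)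
    (hc : IsLeast {s | (s, r) ∈ S} (c - 1)) :
    joinHooks c r (hooksWithin S l c) (hooksWithin S c r) = S := by
  ext ⟨s, e⟩
  simp only [mem_joinHooks, mem_hooksWithin]
  constructor
  · rintro (⟨rfl, rfl⟩ | ⟨rfl, rfl⟩ | h | h)
    exacts [hS.small_mem hc.1, hc.1, h.1, h.1]
  · intro h
    grind [hS.mem_cases hc h, hS.bounds h]

theorem extend_or_join (hS : IsHookConfig p f l (r + 1) S) :
    (IsHookConfig p f l r S ∧ (l < r → f (r - 1) < f r)) ∨
    ∃ c A B, l < c ∧ c ≤ r ∧ Joinable p f c r ∧ IsHookConfig p f l c A ∧ IsHookConfig p f c r B ∧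
      joinHooks c r A B = S := by
  by_cases hr : ∀ s, (s, r) ∉ S
  · exact .inl ⟨hS.of_succ hr, hS.letter_lt_of_forall_notMem hr⟩
  push Not at hr
  obtain ⟨s, hs, hleast⟩ : ∃ s, IsLeast {s | (s, r) ∈ S} s :=
    ⟨_, Nat.sInf_mem hr, fun _ => Nat.sInf_le⟩
  have hbounds := hS.bounds hs
  have hlc : l < s + 1 := by omega
  have hc : IsLeast {s | (s, r) ∈ S} (s + 1 - 1) := ⟨hs, hleast⟩
  exact .inr ⟨s + 1, _, _, hlc, hbounds.2.1, hS.joinable hlc hc, hS.restrict_left hc,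
    hS.restrict_right hlc hc, hS.joinHooks_hooksWithin hc⟩

theorem letter_le_last (hS : IsHookConfig p f l r S) {i : ℕ} (hli : l ≤ i) (hir : i < r) :
    f i ≤ f (r - 1) := by
  induction r using Nat.strong_induction_on generalizing l S with
  | _ r ih =>
    obtain ⟨r, rfl⟩ : ∃ k, r = k + 1 := ⟨r - 1, by omega⟩
    rw [Nat.add_sub_cancel]
    rcases (Nat.le_of_lt_succ hir).eq_or_lt with rfl | hir
    · exact le_rfl
    rcases hS.extend_or_join with ⟨hS, hlt⟩ | ⟨c, A, B, -, hcr, hJ, hA, hB, -⟩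
    · exact (ih r r.lt_succ_self hS hli hir).trans (hlt (hli.trans_lt hir)).le
    · rcases lt_or_ge i c with hic | hci
      · exact (ih c (Nat.lt_succ_of_le hcr) hA hli hic).trans hJ.1
      · exact (ih r r.lt_succ_self hB hci hir).trans hJ.2.1

end IsHookConfig

end HookConfig

section Weights

variable {α : Type*} [LinearOrder α] {p : α → α → Prop} {f : ℕ → α} {l r c : ℕ}
  {S A B : Finset (ℕ × ℕ)}

/-- The hooks of `S` that the point at position `i` sees when looking up: those lying above it and
those having it as their northeast endpoint. -/
def seenHooks (f : ℕ → α) (S : Finset (ℕ × ℕ)) (i : ℕ) : Finset (ℕ × ℕ) :=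
  {h ∈ S | h.1 < i ∧ i < h.2 ∧ f i ≤ f h.2 ∨ h.2 = i}

/-- The number of points of `[l, r)` colored by the sky. -/
def skyCount (f : ℕ → α) (l r : ℕ) (S : Finset (ℕ × ℕ)) : ℕ :=
  #{i ∈ Ico l r | seenHooks f S i = ∅}

/-- The number of points of `[l, r)` with the color of the hook `h`. -/
def hookCount (f : ℕ → α) (l r : ℕ) (S : Finset (ℕ × ℕ)) (h : ℕ × ℕ) : ℕ :=
  #{i ∈ Ico l r | h ∈ seenHooks f S i ∧ ∀ h' ∈ seenHooks f S i, h'.1 ≤ h.1}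

/-- The factor of `C_q` that comes from the colors of the hooks. -/
def hookWeight (f : ℕ → α) (l r : ℕ) (S : Finset (ℕ × ℕ)) : ℕ :=
  ∏ h ∈ S, catalan (hookCount f l r S h)

theorem mem_seenHooks {i s e : ℕ} :
    (s, e) ∈ seenHooks f S i ↔ (s, e) ∈ S ∧ (s < i ∧ i < e ∧ f i ≤ f e ∨ e = i) := by
  simp [seenHooks]

theorem skyCount_self (f : ℕ → α) (l : ℕ) (S : Finset (ℕ × ℕ)) : skyCount f l l S = 0 := by
  simp [skyCount]

namespace IsHookConfig

theorem seenHooks_of_le (hS : IsHookConfig p f l r S) {i : ℕ} (hi : r ≤ i) :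
    seenHooks f S i = ∅ := by
  refine eq_empty_of_forall_notMem fun h hh => ?_
  have := mem_seenHooks.1 hh
  have := hS.bounds this.1
  omega

theorem skyCount_extend (hS : IsHookConfig p f l r S) (hlr : l ≤ r) :
    skyCount f l (r + 1) S = skyCount f l r S + 1 := by
  rw [skyCount, ← insert_Ico_right_eq_Ico_add_one hlr, filter_insert,
    if_pos (hS.seenHooks_of_le le_rfl), card_insert_of_notMem (by simp), skyCount]

theorem hookWeight_extend (hS : IsHookConfig p f l r S) (hlr : l ≤ r) :
    hookWeight f l (r + 1) S = hookWeight f l r S := by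
  refine prod_congr rfl fun h _ => ?_
  rw [hookCount, ← insert_Ico_right_eq_Ico_add_one hlr, filter_insert,
    if_neg (by simp [hS.seenHooks_of_le le_rfl]), hookCount]

theorem seenHooks_join_left (hB : IsHookConfig p f c r B) (hcr : c ≤ r) {i : ℕ} (hi : i < c) :
    seenHooks f (joinHooks c r A B) i = seenHooks f A i := by
  ext ⟨s, e⟩
  grind [mem_seenHooks, mem_joinHooks, → bounds]

theorem seenHooks_join_right (hA : IsHookConfig p f l c A) (hB : IsHookConfig p f c r B)
    (hJ : Joinable p f c r) {i : ℕ} (hci : c ≤ i) (hir : i < r) (hc : 0 < c) :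
    seenHooks f (joinHooks c r A B) i = insert (c - 1, r) (seenHooks f B i) := by
  have hfi : f i ≤ f r := (hB.letter_le_last hci hir).trans hJ.2.1
  ext ⟨s, e⟩
  grind [mem_seenHooks, mem_joinHooks, → bounds]

theorem seenHooks_join_last (hA : IsHookConfig p f l c A) (hB : IsHookConfig p f c r B)
    (hcr : c ≤ r) : seenHooks f (joinHooks c r A B) r = {(r - 1, r), (c - 1, r)} := by
  ext ⟨s, e⟩
  grind [mem_seenHooks, mem_joinHooks, → bounds]

theorem skyCount_join (hA : IsHookConfig p f l c A) (hB : IsHookConfig p f c r B) (hlc : l < c)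
    (hcr : c ≤ r) (hJ : Joinable p f c r) :
    skyCount f l (r + 1) (joinHooks c r A B) = skyCount f l c A := by
  unfold skyCount
  congr 1
  ext i
  simp only [mem_filter, mem_Ico]
  rcases lt_or_ge i c with hic | hci
  · grind [seenHooks_join_left hB hcr hic]
  · have seen : i < r + 1 → (seenHooks f (joinHooks c r A B) i).Nonempty := fun hir => by
      rcases Nat.lt_succ_iff_lt_or_eq.1 hir with hir | rfl
      · simp [seenHooks_join_right hA hB hJ hci hir (by omega)]
      · simp [seenHooks_join_last hA hB hcr]
    grind

theorem hookCount_join_last (hA : IsHookConfig p f l c A) (hB : IsHookConfig p f c r B)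
    (hlc : l < c) (hcr : c ≤ r) (hJ : Joinable p f c r) :
    hookCount f l (r + 1) (joinHooks c r A B) (r - 1, r) = 1 := by
  rw [hookCount, card_eq_one]
  refine ⟨r, ext fun i => ?_⟩
  simp only [mem_filter, mem_Ico, mem_singleton]
  rcases lt_trichotomy i r with hir | rfl | hri
  · have unseen : (r - 1, r) ∉ seenHooks f (joinHooks c r A B) i := by
      grind [mem_seenHooks]
    grind
  · grind [seenHooks_join_last hA hB hcr]
  · grind

theorem hookCount_join_first (hA : IsHookConfig p f l c A) (hB : IsHookConfig p f c r B)
    (hlc : l < c) (hcr : c < r) (hJ : Joinable p f c r) :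
    hookCount f l (r + 1) (joinHooks c r A B) (c - 1, r) = skyCount f c r B := by
  unfold hookCount skyCount
  congr 1
  ext i
  simp only [mem_filter, mem_Ico]
  rcases lt_or_ge i c with hic | hci
  · grind [mem_seenHooks]
  rcases lt_trichotomy i r with hir | rfl | hri
  · have left_of_seen : ∀ h ∈ seenHooks f B i, c - 1 < h.1 := by
      grind [mem_seenHooks, → bounds]
    have rightmost_iff : (∀ h ∈ seenHooks f B i, h.1 ≤ c - 1) ↔ seenHooks f B i = ∅ :=
      ⟨fun hle => eq_empty_of_forall_notMem fun h hh => (left_of_seen h hh).not_ge (hle h hh),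
        fun h => by simp [h]⟩
    simp only [seenHooks_join_right hA hB hJ hci hir (by omega), mem_insert, true_or,
      forall_eq_or_imp, le_refl, true_and, rightmost_iff]
    grind only
  · simp only [seenHooks_join_last hA hB hcr.le, mem_insert, mem_singleton, forall_eq_or_imp]
    omega
  · grind

theorem hookCount_join_of_mem_left (hA : IsHookConfig p f l c A) (hB : IsHookConfig p f c r B)
    (hcr : c ≤ r) {h : ℕ × ℕ} (hh : h ∈ A) :
    hookCount f l (r + 1) (joinHooks c r A B) h = hookCount f l c A h := by
  unfold hookCount
  congr 1
  ext i
  simp only [mem_filter, mem_Ico]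
  rcases lt_or_ge i c with hic | hci
  · grind [seenHooks_join_left hB hcr hic]
  · have unseen : h ∉ seenHooks f (joinHooks c r A B) i := by
      grind [mem_seenHooks, → bounds]
    grind

theorem hookCount_join_of_mem_right (hA : IsHookConfig p f l c A) (hB : IsHookConfig p f c r B)
    (hlc : l < c) (hJ : Joinable p f c r) {h : ℕ × ℕ} (hh : h ∈ B) :
    hookCount f l (r + 1) (joinHooks c r A B) h = hookCount f c r B h := by
  unfold hookCount
  congr 1
  ext i
  have hbounds := hB.bounds hh
  simp only [mem_filter, mem_Ico]
  by_cases hi : c ≤ i ∧ i < r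
  · have hne : h ≠ (c - 1, r) := by grind
    simp only [seenHooks_join_right hA hB hJ hi.1 hi.2 (by omega), mem_insert, hne, false_or,
      forall_eq_or_imp]
    grind only
  · have unseen : h ∉ seenHooks f (joinHooks c r A B) i := by
      grind [mem_seenHooks]
    grind

theorem hookWeight_join (hA : IsHookConfig p f l c A) (hB : IsHookConfig p f c r B)
    (hlc : l < c) (hcr : c ≤ r) (hJ : Joinable p f c r) :
    hookWeight f l (r + 1) (joinHooks c r A B) =
      hookWeight f l c A * (hookWeight f c r B * catalan (skyCount f c r B)) := by
  have disjoint : Disjoint A B :=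
    disjoint_left.2 fun h hh hh' => by grind [→ bounds]
  have first_notMem : (c - 1, r) ∉ A ∪ B := by
    simp [hA.notMem_of_le hcr, hB.notMem_of_le le_rfl]
  have first : catalan (hookCount f l (r + 1) (joinHooks c r A B) (c - 1, r)) =
      catalan (skyCount f c r B) := by
    rcases hcr.eq_or_lt with rfl | hcr
    · simp [hookCount_join_last hA hB hlc hcr hJ, skyCount_self]
    · rw [hookCount_join_first hA hB hlc hcr hJ]
  rw [hookWeight, joinHooks, prod_insert_of_eq_one_if_notMem, ← joinHooks,
    prod_insert first_notMem, prod_union disjoint, first, mul_comm, mul_assoc, hookWeight,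
    hookWeight]
  · congr 1
    · exact prod_congr rfl fun h hh => by rw [hookCount_join_of_mem_left hA hB hcr hh]
    · congr 1
      exact prod_congr rfl fun h hh => by rw [hookCount_join_of_mem_right hA hB hlc hJ hh]
  · intro _
    rw [← joinHooks, hookCount_join_last hA hB hlc hcr hJ, catalan_one]

end IsHookConfig

end Weights

section ConfigSum

variable {α : Type*} [LinearOrder α] {p : α → α → Prop} {f : ℕ → α} {l r c : ℕ}
  {A B : Finset (ℕ × ℕ)}

open Classical in
/-- The set of all hook configurations on `[l, r)`. -/
noncomputable def configs (p : α → α → Prop) (f : ℕ → α) (l r : ℕ) : Finset (Finset (ℕ × ℕ)) :=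
  {S ∈ (Ico l r ×ˢ Ico l r).powerset | IsHookConfig p f l r S}

/-- The sum of the hook weights of all configurations on `[l, r)`, with the factor `g q₀` for the
number `q₀` of points colored by the sky; `g = catalan` gives the sum of all `C_q`. -/
noncomputable def configSum (p : α → α → Prop) (f : ℕ → α) (l r : ℕ) (g : ℕ → ℕ) : ℕ :=
  ∑ S ∈ configs p f l r, hookWeight f l r S * g (skyCount f l r S)

/-- The letter at `c` is the first one of an interval starting at `l` or larger than the letter
before it. -/
def Rises (f : ℕ → α) (l c : ℕ) : Prop := l < c → f (c - 1) < f c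

instance (f : ℕ → α) (l c : ℕ) : Decidable (Rises f l c) :=
  inferInstanceAs (Decidable (_ → _))

open Classical in
/-- The possible positions right after the leftmost southwest endpoint of a hook to `r`. -/
noncomputable def joints (p : α → α → Prop) (f : ℕ → α) (l r : ℕ) : Finset ℕ :=
  {c ∈ Ioc l r | Joinable p f c r}

theorem mem_configs {S : Finset (ℕ × ℕ)} : S ∈ configs p f l r ↔ IsHookConfig p f l r S := by
  simp only [configs, mem_filter, mem_powerset, and_iff_right_iff_imp]
  rintro hS ⟨s, e⟩ h
  have := hS.bounds h
  simp only [mem_product, mem_Ico]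
  omega

theorem mem_joints : c ∈ joints p f l r ↔ (l < c ∧ c ≤ r) ∧ Joinable p f c r := by
  simp [joints]

theorem configSum_self (p : α → α → Prop) (f : ℕ → α) (l : ℕ) (g : ℕ → ℕ) :
    configSum p f l l g = g 0 := by
  have : configs p f l l = {∅} := ext fun S => by
    rw [mem_configs, mem_singleton]
    exact ⟨IsHookConfig.eq_empty, fun h => h ▸ .empty p f l⟩
  simp [configSum, this, hookWeight, skyCount_self]

theorem exists_isHookConfig_of_configSum_ne_zero {g : ℕ → ℕ} (h : configSum p f l r g ≠ 0) :
    ∃ S, IsHookConfig p f l r S := by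
  obtain ⟨S, hS, -⟩ := exists_ne_zero_of_sum_ne_zero h
  exact ⟨S, mem_configs.1 hS⟩

theorem hooksWithin_join_left (hA : IsHookConfig p f l c A) (hB : IsHookConfig p f c r B)
    (hcr : c ≤ r) : hooksWithin (joinHooks c r A B) l c = A := by
  ext ⟨s, e⟩
  grind [mem_hooksWithin, mem_joinHooks, → IsHookConfig.bounds]

theorem hooksWithin_join_right (hA : IsHookConfig p f l c A) (hB : IsHookConfig p f c r B) :
    hooksWithin (joinHooks c r A B) c r = B := by
  ext ⟨s, e⟩
  grind [mem_hooksWithin, mem_joinHooks, → IsHookConfig.bounds]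

theorem isLeast_join (hA : IsHookConfig p f l c A) (hB : IsHookConfig p f c r B) (hcr : c ≤ r) :
    IsLeast {s | (s, r) ∈ joinHooks c r A B} (c - 1) := by
  refine ⟨by simp [mem_joinHooks], fun s hs => ?_⟩
  rcases mem_joinHooks.1 hs with hs | hs | hs | hs
  · omega
  · omega
  · exact absurd hs (hA.notMem_of_le hcr)
  · exact absurd hs (hB.notMem_of_le le_rfl)

theorem joinHooks_injOn (p : α → α → Prop) (f : ℕ → α) (l r : ℕ) :
    Set.InjOn (fun x : Σ _ : ℕ, Finset (ℕ × ℕ) × Finset (ℕ × ℕ) => joinHooks x.1 r x.2.1 x.2.2)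
      ((joints p f l r).sigma fun c => configs p f l c ×ˢ configs p f c r) := by
  rintro ⟨c, A, B⟩ hx ⟨c', A', B'⟩ hx' (heq : joinHooks c r A B = joinHooks c' r A' B')
  simp only [coe_sigma, Set.mem_sigma_iff, mem_coe, mem_joints, mem_product, mem_configs] at hx hx'
  obtain ⟨⟨⟨hlc, hcr⟩, -⟩, hA, hB⟩ := hx
  obtain ⟨⟨⟨hlc', hcr'⟩, -⟩, hA', hB'⟩ := hx'
  have hpred : c - 1 = c' - 1 :=
    (isLeast_join hA hB hcr).unique (heq ▸ isLeast_join hA' hB' hcr')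
  obtain rfl : c = c' := by omega
  have left_eq : A = A' := by
    rw [← hooksWithin_join_left hA hB hcr, heq, hooksWithin_join_left hA' hB' hcr]
  have right_eq : B = B' := by
    rw [← hooksWithin_join_right hA hB, heq, hooksWithin_join_right hA' hB']
  rw [left_eq, right_eq]

open Classical in
theorem sum_configs_filter_notMem (hlr : l ≤ r) (g : ℕ → ℕ) :
    ∑ S ∈ configs p f l (r + 1) with ∀ s, (s, r) ∉ S,
        hookWeight f l (r + 1) S * g (skyCount f l (r + 1) S) =
      if Rises f l r then configSum p f l r fun m => g (m + 1) else 0 := by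
  split_ifs with hr
  · have : {S ∈ configs p f l (r + 1) | ∀ s, (s, r) ∉ S} = configs p f l r := by
      ext S
      simp only [mem_filter, mem_configs]
      exact ⟨fun h => h.1.of_succ h.2, fun h => ⟨h.extend hr, fun s => h.notMem_of_le le_rfl⟩⟩
    rw [this]
    refine sum_congr rfl fun S hS => ?_
    rw [(mem_configs.1 hS).skyCount_extend hlr, (mem_configs.1 hS).hookWeight_extend hlr]
  · refine sum_eq_zero fun S hS => absurd ?_ hr
    rw [mem_filter, mem_configs] at hS
    exact hS.1.letter_lt_of_forall_notMem hS.2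

open Classical in
theorem sum_configs_filter_mem (p : α → α → Prop) (f : ℕ → α) (l r : ℕ) (g : ℕ → ℕ) :
    ∑ S ∈ configs p f l (r + 1) with ¬ ∀ s, (s, r) ∉ S,
        hookWeight f l (r + 1) S * g (skyCount f l (r + 1) S) =
      ∑ c ∈ joints p f l r, configSum p f l c g * configSum p f c r catalan := by
  simp only [configSum, sum_mul_sum, ← sum_product']
  rw [sum_sigma']
  refine (sum_nbij _ ?_ (joinHooks_injOn p f l r) ?_ ?_).symm
  · rintro ⟨c, A, B⟩ hx
    simp only [mem_sigma, mem_joints, mem_product, mem_configs, mem_filter] at hx ⊢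
    obtain ⟨⟨⟨hlc, hcr⟩, hJ⟩, hA, hB⟩ := hx
    exact ⟨hA.join hB hlc hcr hJ, fun h => h (c - 1) (isLeast_join hA hB hcr).1⟩
  · intro S hS
    rw [mem_coe, mem_filter, mem_configs] at hS
    rcases hS.1.extend_or_join with ⟨hS', -⟩ | ⟨c, A, B, hlc, hcr, hJ, hA, hB, rfl⟩
    · exact absurd (fun s => hS'.notMem_of_le le_rfl) hS.2
    · exact ⟨⟨c, A, B⟩, by simp [mem_joints, mem_configs, *], rfl⟩
  · rintro ⟨c, A, B⟩ hx
    simp only [mem_sigma, mem_joints, mem_product, mem_configs] at hx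
    obtain ⟨⟨⟨hlc, hcr⟩, hJ⟩, hA, hB⟩ := hx
    simp only [hA.skyCount_join hB hlc hcr hJ, hA.hookWeight_join hB hlc hcr hJ]
    ring

theorem configSum_succ (p : α → α → Prop) (f : ℕ → α) (hlr : l ≤ r) (g : ℕ → ℕ) :
    configSum p f l (r + 1) g =
      (if Rises f l r then configSum p f l r fun m => g (m + 1) else 0) +
        ∑ c ∈ joints p f l r, configSum p f l c g * configSum p f c r catalan := by
  classical
  rw [configSum, ← sum_filter_add_sum_filter_not _ fun S => ∀ s, (s, r) ∉ S,
    sum_configs_filter_notMem hlr, sum_configs_filter_mem]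

theorem ite_rises_configSum (hlr : l ≤ r) (g h : ℕ → ℕ)
    (ih : configSum p f l r (fun m => ∑ ij ∈ antidiagonal m, g ij.1 * h ij.2) =
      ∑ c ∈ Ico l r with Rises f l c, configSum p f l c g * configSum p f c r h +
        configSum p f l r g * h 0) :
    (if Rises f l r then configSum p f l r fun m => ∑ ij ∈ antidiagonal m, g ij.1 * h ij.2
      else 0) = ∑ c ∈ Ico l (r + 1) with Rises f l c,
        configSum p f l c g * if Rises f c r then configSum p f c r h else 0 := by
  have rises_iff {c : ℕ} (hc : c ∈ Ico l r) : Rises f c r ↔ Rises f l r := by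
    rw [mem_Ico] at hc
    simp [Rises, hc.2, hc.1.trans_lt hc.2]
  rw [← insert_Ico_right_eq_Ico_add_one hlr, filter_insert]
  have self : Rises f r r := fun h => absurd h (lt_irrefl r)
  have restrict : ∑ c ∈ Ico l r with Rises f l c,
      configSum p f l c g * (if Rises f c r then configSum p f c r h else 0) =
      if Rises f l r then ∑ c ∈ Ico l r with Rises f l c,
        configSum p f l c g * configSum p f c r h else 0 := by
    split_ifs with hr
    · exact sum_congr rfl fun c hc => by rw [if_pos ((rises_iff (mem_filter.1 hc).1).2 hr)]
    · exact sum_eq_zero fun c hc => by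
        rw [if_neg (mt (rises_iff (mem_filter.1 hc).1).1 hr), mul_zero]
  split_ifs with hr
  · rw [sum_insert (by simp), restrict, if_pos hr, if_pos self, configSum_self, ih, add_comm]
  · rw [restrict, if_neg hr]

theorem configSum_mul_add (p : α → α → Prop) (f : ℕ → α) (l r : ℕ) (g g' : ℕ → ℕ) (k : ℕ) :
    configSum p f l r (fun m => g m * k + g' m) =
      configSum p f l r g * k + configSum p f l r g' := by
  simp only [configSum, mul_add, sum_add_distrib, sum_mul, mul_assoc]

theorem sum_joints_sum_Ico_comm (p : α → α → Prop) (f : ℕ → α) (l r : ℕ) (a b : ℕ → ℕ)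
    (t : ℕ → ℕ → ℕ) :
    ∑ e ∈ joints p f l r, (∑ c ∈ Ico l e with Rises f l c, a c * t c e) * b e =
      ∑ c ∈ Ico l (r + 1) with Rises f l c, a c * ∑ e ∈ joints p f c r, t c e * b e := by
  simp only [sum_mul, mul_sum, mul_assoc]
  refine sum_comm' fun e c => ?_
  simp only [mem_joints, mem_filter, mem_Ico]
  grind

/-- The points colored by the sky are cut into an initial segment weighted by `g` and a final one
weighted by `h`; `c` is the position at which a nonempty final segment starts. -/
theorem configSum_sum_antidiagonal (p : α → α → Prop) (f : ℕ → α) (hlr : l ≤ r) (g h : ℕ → ℕ) :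
    configSum p f l r (fun m => ∑ ij ∈ antidiagonal m, g ij.1 * h ij.2) =
      ∑ c ∈ Ico l r with Rises f l c, configSum p f l c g * configSum p f c r h +
        configSum p f l r g * h 0 := by
  induction r using Nat.strong_induction_on generalizing h with
  | _ r ih =>
    rcases hlr.eq_or_lt with rfl | hlr
    · simp [configSum_self]
    obtain ⟨r, rfl⟩ : ∃ k, r = k + 1 := ⟨r - 1, by omega⟩
    have hlr' : l ≤ r := Nat.le_of_lt_succ hlr
    have expand_right : ∑ c ∈ Ico l (r + 1) with Rises f l c,
        configSum p f l c g * configSum p f c (r + 1) h =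
        ∑ c ∈ Ico l (r + 1) with Rises f l c, configSum p f l c g *
            (if Rises f c r then configSum p f c r fun m => h (m + 1) else 0) +
          ∑ c ∈ Ico l (r + 1) with Rises f l c, configSum p f l c g *
            ∑ e ∈ joints p f c r, configSum p f c e h * configSum p f e r catalan := by
      rw [← sum_add_distrib]
      refine sum_congr rfl fun c hc => ?_
      rw [configSum_succ p f (by grind), mul_add]
    have expand_joint : ∀ e ∈ joints p f l r,
        configSum p f l e (fun m => ∑ ij ∈ antidiagonal m, g ij.1 * h ij.2) *
          configSum p f e r catalan =
        (∑ c ∈ Ico l e with Rises f l c, configSum p f l c g * configSum p f c e h) *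
            configSum p f e r catalan +
          configSum p f l e g * configSum p f e r catalan * h 0 := by
      intro e he
      rw [mem_joints] at he
      rw [ih e (by omega) he.1.1.le]
      ring
    rw [expand_right, ← ite_rises_configSum hlr' _ _ (ih r r.lt_succ_self hlr' _),
      ← sum_joints_sum_Ico_comm, configSum_succ p f hlr', configSum_succ p f hlr',
      sum_congr rfl expand_joint, sum_add_distrib]
    simp only [Nat.sum_antidiagonal_succ', configSum_mul_add, ← sum_mul]
    split_ifs <;> ring

end ConfigSum

section RootSplits

variable {α : Type*} {p : α → α → Prop} {f : ℕ → α} {l r c : ℕ} {A B : Finset (ℕ × ℕ)}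

/-- The letters of `f` on `[l, c)` and on `[c, r)` may form the left and the right part of a word
with root `f r`, where the tie rule `p` decides the place of the letters equal to the root. -/
def IsRootSplit (p : α → α → Prop) (f : ℕ → α) (l c r : ℕ) : Prop :=
  (∀ i ∈ Ico l c, p (f i) (f r)) ∧ ∀ i ∈ Ico c r, ¬ p (f r) (f i)

open Classical in
/-- The positions that split the interval `[l, r)` into a left and a right part below the root at
`r`. -/
noncomputable def rootSplits (p : α → α → Prop) (f : ℕ → α) (l r : ℕ) : Finset ℕ :=
  {c ∈ Icc l r | IsRootSplit p f l c r}

theorem mem_rootSplits : c ∈ rootSplits p f l r ↔ (l ≤ c ∧ c ≤ r) ∧ IsRootSplit p f l c r := by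
  simp [rootSplits]

variable [LinearOrder α]

theorem isRootSplit_iff (hp : IsTieRule p) (hA : IsHookConfig p f l c A)
    (hB : IsHookConfig p f c r B) : IsRootSplit p f l c r ↔
      (l < c → p (f (c - 1)) (f r)) ∧ (c < r → ¬ p (f r) (f (r - 1))) := by
  refine and_congr ⟨fun h hlc => h _ (by grind), fun h i hi => ?_⟩
    ⟨fun h hcr => h _ (by grind), fun h i hi hpi => ?_⟩ <;> rw [mem_Ico] at hi
  · exact hp.of_le_of_rel (hA.letter_le_last hi.1 hi.2) (h (hi.1.trans_lt hi.2))
  · exact h (hi.1.trans_lt hi.2) (hp.of_rel_of_le hpi (hB.letter_le_last hi.1 hi.2))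

theorem isRootSplit_iff_rises_or_joinable (hp : IsTieRule p) (hlc : l < c) (hcr : c < r)
    (hA : IsHookConfig p f l c A) (hB : IsHookConfig p f c r B) :
    IsRootSplit p f l c r ↔ (Rises f l r ∧ Rises f l c) ∨ Joinable p f c r := by
  have letter_le : f c ≤ f (r - 1) := hB.letter_le_last le_rfl hcr
  simp only [isRootSplit_iff hp hA hB, Rises, Joinable, hlc, hcr, hlc.trans hcr, forall_const]
  constructor
  · rintro ⟨hleft, hright⟩
    have := hp.le hleft
    have := hp.le_of_not_rel hright
    grind
  · rintro (⟨hr, hc⟩ | hJ)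
    · exact ⟨hp.of_lt (hc.trans (letter_le.trans_lt hr)), fun h => hr.not_ge (hp.le h)⟩
    · exact hJ.2.2.2

open Classical in
theorem ite_isRootSplit_of_lt_of_lt (hp : IsTieRule p) (hlc : l < c) (hcr : c < r) (g h : ℕ → ℕ) :
    (if IsRootSplit p f l c r then configSum p f l c g * configSum p f c r h else 0) =
      (if Rises f l r then if Rises f l c then configSum p f l c g * configSum p f c r h else 0
        else 0) +
        if Joinable p f c r then configSum p f l c g * configSum p f c r h else 0 := by
  by_cases hzero : configSum p f l c g * configSum p f c r h = 0
  · simp only [hzero, ite_self]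
  obtain ⟨A, hA⟩ := exists_isHookConfig_of_configSum_ne_zero (left_ne_zero_of_mul hzero)
  obtain ⟨B, hB⟩ := exists_isHookConfig_of_configSum_ne_zero (right_ne_zero_of_mul hzero)
  have not_both : Rises f l r → Rises f l c → ¬ Joinable p f c r := fun hr hc hJ =>
    hJ.2.2.1.elim (hc hlc).not_ge (hr (hlc.trans hcr)).not_ge
  simp only [isRootSplit_iff_rises_or_joinable hp hlc hcr hA hB]
  grind

open Classical in
theorem ite_isRootSplit_left_add_right (hp : IsTieRule p) (hlr : l < r) (g : ℕ → ℕ) :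
    (if IsRootSplit p f l l r then configSum p f l r g else 0) +
        (if IsRootSplit p f l r r then configSum p f l r g else 0) =
      (if Rises f l r then configSum p f l r g + configSum p f l r g else 0) +
        if Joinable p f r r then configSum p f l r g else 0 := by
  by_cases hzero : configSum p f l r g = 0
  · simp only [hzero, add_zero, ite_self]
  obtain ⟨S, hS⟩ := exists_isHookConfig_of_configSum_ne_zero hzero
  have left_iff : IsRootSplit p f l l r ↔ ¬ p (f r) (f (r - 1)) := by
    simp [isRootSplit_iff hp (.empty p f l) hS, hlr]
  have right_iff : IsRootSplit p f l r r ↔ p (f (r - 1)) (f r) := by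
    simp [isRootSplit_iff hp hS (.empty p f r), hlr]
  have rises_iff : Rises f l r ↔ f (r - 1) < f r := by simp [Rises, hlr]
  have joinable_iff : Joinable p f r r ↔ f (r - 1) = f r := by
    simp [Joinable, le_antisymm_iff]
  simp only [left_iff, right_iff, rises_iff, joinable_iff]
  rcases lt_trichotomy (f (r - 1)) (f r) with hlt | heq | hgt
  · simp [hlt, hlt.ne, hp.of_lt hlt, mt hp.le hlt.not_ge]
  · by_cases hpr : p (f r) (f r) <;> simp [heq, hpr]
  · simp [hgt.ne', hgt.not_gt, hp.of_lt hgt, mt hp.le hgt.not_ge]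

theorem configSum_catalan_succ (hp : IsTieRule p) (hlr : l ≤ r) :
    configSum p f l (r + 1) catalan =
      ∑ c ∈ rootSplits p f l r, configSum p f l c catalan * configSum p f c r catalan := by
  classical
  have rises_self : Rises f l l := fun h => absurd h (lt_irrefl l)
  simp only [configSum_succ p f hlr, catalan_succ', configSum_sum_antidiagonal p f hlr]
  simp only [joints, rootSplits, sum_filter]
  rcases hlr.eq_or_lt with rfl | hlr
  · simp +contextual [configSum_self, rises_self, IsRootSplit, not_lt_of_ge]
  rw [← Ioc_insert_left hlr.le, sum_insert left_notMem_Ioc, ← Ioo_insert_left hlr,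
    sum_insert left_notMem_Ioo, ← Ioo_insert_right hlr]
  simp only [sum_insert right_notMem_Ioo, if_pos rises_self, configSum_self, catalan_zero,
    one_mul, mul_one]
  conv_rhs => rw [← add_assoc, ite_isRootSplit_left_add_right hp hlr]
  have interior := sum_congr (s₁ := Ioo l r) rfl fun c hc => ite_isRootSplit_of_lt_of_lt
    (f := f) hp (mem_Ioo.1 hc).1 (mem_Ioo.1 hc).2 catalan catalan
  rw [interior, sum_add_distrib]
  by_cases hr : Rises f l r
  · simp only [if_pos hr]
    ring
  · simp only [if_neg hr, sum_const_zero]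
    ring

end RootSplits

section Postorder

variable {α : Type*} {p : α → α → Prop} {g : List α → List α} {f : ℕ → α} {l r c : ℕ}
  {A B A' B' : List α} {n : α}

/-- The function `g` reads in postorder the binary tree whose root is the letter `n` in the
decomposition `A n B` selected by the tie rule `p`. -/
structure IsPostorder (p : α → α → Prop) (g : List α → List α) : Prop where
  nil : g [] = []
  append_cons : ∀ {A B : List α} {n : α}, (∀ x ∈ A, p x n) → (∀ x ∈ B, ¬ p n x) →
    g (A ++ n :: B) = g A ++ g B ++ [n]

theorem IsTieRule.exists_append_cons [LinearOrder α] (hp : IsTieRule p) {w : List α}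
    (hw : w ≠ []) : ∃ (A : List α) (n : α) (B : List α),
      w = A ++ n :: B ∧ (∀ x ∈ A, p x n) ∧ ∀ x ∈ B, ¬ p n x := by
  induction w with
  | nil => exact absurd rfl hw
  | cons x t ih =>
    rcases eq_or_ne t [] with rfl | ht
    · exact ⟨[], x, [], by simp⟩
    obtain ⟨A, n, B, rfl, hA, hB⟩ := ih ht
    by_cases hxn : p x n
    · exact ⟨x :: A, n, B, rfl, List.forall_mem_cons.2 ⟨hxn, hA⟩, hB⟩
    refine ⟨[], x, A ++ n :: B, rfl, by simp, fun y hy hxy => ?_⟩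
    rw [List.mem_append, List.mem_cons] at hy
    rcases hy with hy | rfl | hy
    · exact hxn (hp.of_le_of_rel (hp.le hxy) (hA y hy))
    · exact hxn hxy
    · exact hB y hy (hp.of_le_of_rel (hp.le_of_not_rel hxn) hxy)

theorem append_cons_inj_of_rel (hA : ∀ x ∈ A, p x n) (hB : ∀ x ∈ B, ¬ p n x)
    (hA' : ∀ x ∈ A', p x n) (hB' : ∀ x ∈ B', ¬ p n x) (h : A ++ n :: B = A' ++ n :: B') :
    A = A' ∧ B = B' := by
  simp only [List.append_eq_append_iff, List.cons_eq_append_iff, List.cons_eq_cons] at h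
  rcases h with ⟨_, rfl, ⟨rfl, -, rfl⟩ | ⟨_, rfl, rfl⟩⟩ |
    ⟨_, rfl, ⟨rfl, -, rfl⟩ | ⟨_, rfl, rfl⟩⟩
  · simp
  · exact absurd (hA' n (by simp)) (hB n (by simp))
  · simp
  · exact absurd (hA n (by simp)) (hB' n (by simp))

namespace IsPostorder

open scoped List in
theorem perm [LinearOrder α] (hp : IsTieRule p) (hg : IsPostorder p g) (w : List α) :
    (g w).Perm w := by
  induction hk : w.length using Nat.strong_induction_on generalizing w with
  | _ k ih =>
    rcases eq_or_ne w [] with rfl | hw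
    · rw [hg.nil]
    obtain ⟨A, n, B, rfl, hA, hB⟩ := hp.exists_append_cons hw
    rw [List.length_append, List.length_cons] at hk
    calc g (A ++ n :: B)
      _ = g A ++ g B ++ [n] := hg.append_cons hA hB
      _ ~ A ++ B ++ [n] :=
        ((ih _ (by omega) A rfl).append (ih _ (by omega) B rfl)).append_right [n]
      _ ~ A ++ n :: B := by
        rw [List.append_assoc]
        exact (List.perm_append_singleton n B).append_left A

theorem finite_preimage [LinearOrder α] (hp : IsTieRule p) (hg : IsPostorder p g) (w : List α) :
    (g ⁻¹' {w}).Finite := by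
  refine (List.finite_toSet w.permutations).subset ?_
  rintro x rfl
  exact List.mem_permutations.2 (hg.perm hp x).symm

end IsPostorder

/-- The word formed by the letters of `f` at the positions in `[l, r)`. -/
def segment (f : ℕ → α) (l r : ℕ) : List α := (List.Ico l r).map f

theorem segment_self (f : ℕ → α) (l : ℕ) : segment f l l = [] := by simp [segment]

theorem length_segment (f : ℕ → α) (l r : ℕ) : (segment f l r).length = r - l := by
  simp [segment]

theorem mem_segment {x : α} : x ∈ segment f l r ↔ ∃ i ∈ Finset.Ico l r, f i = x := by
  simp [segment]

theorem segment_append (hlc : l ≤ c) (hcr : c ≤ r) :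
    segment f l c ++ segment f c r = segment f l r := by
  rw [segment, segment, ← List.map_append, List.Ico.append_consecutive hlc hcr, segment]

theorem segment_succ (f : ℕ → α) (hlr : l ≤ r) : segment f l (r + 1) = segment f l r ++ [f r] := by
  simp [segment, List.Ico.succ_top hlr]

theorem exists_eq_segment_of_append_eq (hlr : l ≤ r) (h : A ++ B = segment f l r) :
    ∃ c, l ≤ c ∧ c ≤ r ∧ A = segment f l c ∧ B = segment f c r := by
  have hlen := congrArg List.length h
  rw [List.length_append, length_segment] at hlen
  refine ⟨l + A.length, by omega, by omega, ?_⟩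
  rw [← segment_append (c := l + A.length) (by omega) (by omega)] at h
  exact List.append_inj h (by rw [length_segment]; omega)

namespace IsPostorder

variable [LinearOrder α] (hp : IsTieRule p) (hg : IsPostorder p g)
include hp hg

theorem isRootSplit_iff (hA : g A = segment f l c) (hB : g B = segment f c r) :
    IsRootSplit p f l c r ↔ (∀ x ∈ A, p x (f r)) ∧ ∀ x ∈ B, ¬ p (f r) x := by
  simp only [IsRootSplit, ← (hg.perm hp A).mem_iff, ← (hg.perm hp B).mem_iff, hA, hB, mem_segment,
    forall_exists_index, and_imp, forall_apply_eq_imp_iff₂]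

theorem eq_segment_succ_iff (hlr : l ≤ r) {w : List α} : g w = segment f l (r + 1) ↔
    ∃ c ∈ rootSplits p f l r, ∃ A B, g A = segment f l c ∧ g B = segment f c r ∧
      w = A ++ f r :: B := by
  simp only [mem_rootSplits]
  constructor
  · intro hw
    rw [segment_succ f hlr] at hw
    have : w ≠ [] := by
      rintro rfl
      simp [hg.nil] at hw
    obtain ⟨A, n, B, rfl, hA, hB⟩ := hp.exists_append_cons this
    rw [hg.append_cons hA hB] at hw
    obtain ⟨hAB, hn⟩ := List.append_inj' hw rfl
    obtain rfl : n = f r := List.singleton_inj.1 hn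
    obtain ⟨c, hlc, hcr, hA', hB'⟩ := exists_eq_segment_of_append_eq hlr hAB
    exact ⟨c, ⟨⟨hlc, hcr⟩, (hg.isRootSplit_iff hp hA' hB').2 ⟨hA, hB⟩⟩, A, B, hA', hB', rfl⟩
  · rintro ⟨c, ⟨⟨hlc, hcr⟩, hc⟩, A, B, hA, hB, rfl⟩
    rw [hg.isRootSplit_iff hp hA hB] at hc
    rw [hg.append_cons hc.1 hc.2, hA, hB, segment_append hlc hcr, segment_succ f hlr]

theorem ncard_preimage_segment_succ (hlr : l ≤ r) : (g ⁻¹' {segment f l (r + 1)}).ncard =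
    ∑ c ∈ rootSplits p f l r, (g ⁻¹' {segment f l c}).ncard * (g ⁻¹' {segment f c r}).ncard := by
  let F (w : List α) : Finset (List α) := (hg.finite_preimage hp w).toFinset
  have mem_F {x w : List α} : x ∈ F w ↔ g x = w := by simp [F]
  have ncard_eq (w : List α) : (g ⁻¹' {w}).ncard = #(F w) := Set.ncard_eq_toFinset_card _ _
  simp only [ncard_eq, ← card_product]
  rw [← card_sigma]
  refine (card_nbij (fun x : Σ _ : ℕ, List α × List α => x.2.1 ++ f r :: x.2.2) ?_ ?_ ?_).symm
  · rintro ⟨c, A, B⟩ hx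
    simp only [mem_coe, mem_sigma, mem_product, mem_F] at hx ⊢
    exact (hg.eq_segment_succ_iff hp hlr).2 ⟨c, hx.1, A, B, hx.2.1, hx.2.2, rfl⟩
  · rintro ⟨c, A, B⟩ hx ⟨c', A', B'⟩ hx' (heq : A ++ f r :: B = A' ++ f r :: B')
    simp only [mem_coe, mem_sigma, mem_product, mem_F, mem_rootSplits] at hx hx'
    obtain ⟨⟨⟨hlc, -⟩, hc⟩, hA, hB⟩ := hx
    obtain ⟨⟨⟨hlc', -⟩, hc'⟩, hA', hB'⟩ := hx'
    rw [hg.isRootSplit_iff hp hA hB] at hc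
    rw [hg.isRootSplit_iff hp hA' hB'] at hc'
    obtain ⟨rfl, rfl⟩ := append_cons_inj_of_rel hc.1 hc.2 hc'.1 hc'.2 heq
    have hlen := congrArg List.length (hA.symm.trans hA')
    rw [length_segment, length_segment] at hlen
    obtain rfl : c = c' := by omega
    rfl
  · intro x hx
    obtain ⟨c, hc, A, B, hA, hB, rfl⟩ := (hg.eq_segment_succ_iff hp hlr).1 (mem_F.1 hx)
    exact ⟨⟨c, A, B⟩, by simp [hc, mem_F, hA, hB], rfl⟩

theorem ncard_preimage_segment (hlr : l ≤ r) :
    (g ⁻¹' {segment f l r}).ncard = configSum p f l r catalan := by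
  induction r using Nat.strong_induction_on generalizing l with
  | _ r ih =>
    rcases hlr.eq_or_lt with rfl | hlr
    · have : g ⁻¹' {[]} = {[]} := Set.ext fun w =>
        ⟨fun hw => List.nil_perm.1 (hw ▸ hg.perm hp w), fun hw => hw ▸ hg.nil⟩
      rw [segment_self, configSum_self, catalan_zero, this, Set.ncard_singleton]
    obtain ⟨r, rfl⟩ : ∃ k, r = k + 1 := ⟨r - 1, by omega⟩
    have hlr' : l ≤ r := Nat.le_of_lt_succ hlr
    rw [hg.ncard_preimage_segment_succ hp hlr', configSum_catalan_succ hp hlr']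
    refine sum_congr rfl fun c hc => ?_
    obtain ⟨hlc, hcr⟩ := (mem_rootSplits.1 hc).1
    rw [ih c (by omega) hlc, ih r (by omega) hcr]

end IsPostorder

end Postorder

section FastSlow

theorem fast_eq_of_forall_le {w : Word} {n : ℕ+} (hw : ∀ x ∈ w, x ≤ n) :
    fast w = (w.splitOn n).flatMap fast ++ List.replicate (w.count n) n := by
  by_cases hn : n ∈ w
  · rw [fast_of_ne_nil (List.ne_nil_of_mem hn), (List.max_eq_iff _).2 ⟨hn, hw⟩]
  · simp [List.splitOn_eq_singleton hn, List.count_eq_zero_of_not_mem hn]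

theorem slow_eq_of_forall_le {w : Word} {n : ℕ+} (hw : ∀ x ∈ w, x ≤ n) :
    slow w = ((w.splitOn n).take 1).flatMap slow ++
      ((w.splitOn n).drop 1).flatMap fun A => slow A ++ [n] := by
  by_cases hn : n ∈ w
  · rw [slow_of_ne_nil (List.ne_nil_of_mem hn), (List.max_eq_iff _).2 ⟨hn, hw⟩]
  · simp [List.splitOn_eq_singleton hn]

theorem isPostorder_fast : IsPostorder (· < ·) fast where
  nil := fast_nil
  append_cons {A B n} hA hB := by
    simp only [not_lt] at hB
    have notMem : n ∉ A := fun h => lt_irrefl n (hA n h)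
    have le_root : ∀ x ∈ A ++ n :: B, x ≤ n :=
      List.forall_mem_append.2 ⟨fun x hx => (hA x hx).le, List.forall_mem_cons.2 ⟨le_rfl, hB⟩⟩
    rw [fast_eq_of_forall_le le_root, fast_eq_of_forall_le hB,
      List.splitOn_append_cons_self_of_not_mem notMem, List.count_append, List.count_cons_self,
      List.count_eq_zero_of_not_mem notMem, zero_add, List.replicate_succ']
    simp only [List.flatMap_cons, List.append_assoc]

theorem isPostorder_slow : IsPostorder (· ≤ ·) slow where
  nil := slow_nil
  append_cons {A B n} hA hB := by
    simp only [not_le] at hB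
    have notMem : n ∉ B := fun h => lt_irrefl n (hB n h)
    have le_root : ∀ x ∈ A ++ n :: B, x ≤ n :=
      List.forall_mem_append.2
        ⟨hA, List.forall_mem_cons.2 ⟨le_rfl, fun x hx => (hB x hx).le⟩⟩
    rw [slow_eq_of_forall_le le_root, slow_eq_of_forall_le hA, List.splitOn_append_cons_self,
      List.splitOn_eq_singleton notMem]
    obtain ⟨C, L, hsplit⟩ := List.exists_cons_of_ne_nil (List.splitOn_ne_nil n A)
    simp [hsplit]

end FastSlow

section HookTuples

variable {p : ℕ+ → ℕ+ → Prop} {w : Word}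

theorem ncard_setOf_fin (n : ℕ) (P : ℕ → Prop) [DecidablePred P] :
    {i : Fin n | P i}.ncard = #{i ∈ Ico 0 n | P i} := by
  rw [← Set.ncard_image_of_injective _ Fin.val_injective, ← Set.ncard_coe_finset]
  congr 1
  ext i
  simp only [Set.mem_image, Set.mem_ofPred_eq, coe_filter, mem_Ico]
  exact ⟨by rintro ⟨j, hj, rfl⟩; exact ⟨⟨Nat.zero_le _, j.2⟩, hj⟩,
    fun ⟨hi, h⟩ => ⟨⟨i, hi.2⟩, h, rfl⟩⟩

/-- The letter of `w` at position `i`, extended by `1` beyond the end of `w`. -/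
def letter (w : Word) (i : ℕ) : ℕ+ := w.getD i 1

theorem getElem_eq_letter {i : ℕ} (h : i < w.length) : w[i] = letter w i := by
  simp [letter, h]

theorem getElem_fin_eq_letter (i : Fin w.length) : w[i] = letter w i := getElem_eq_letter i.2

theorem segment_letter (w : Word) : segment (letter w) 0 w.length = w :=
  List.ext_getElem (by simp [length_segment]) fun i _ h => by
    simp [segment, letter, List.Ico, h]

theorem isDescent_iff {d : Fin w.length} : IsDescent w d ↔
    (d : ℕ) + 1 < w.length ∧ letter w (d + 1) ≤ letter w d := by
  rw [← exists_prop]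
  exact exists_congr fun h => by rw [getElem_eq_letter h, getElem_fin_eq_letter]

namespace Hook

theorem letter_sw_le (K : Hook w) : letter w K.sw ≤ letter w K.ne := by
  simpa only [getElem_fin_eq_letter] using K.letter_le

theorem isHorizontal_iff {K : Hook w} : K.IsHorizontal ↔ letter w K.sw = letter w K.ne := by
  rw [IsHorizontal, getElem_fin_eq_letter, getElem_fin_eq_letter]

theorem not_isSmall_iff {K : Hook w} : ¬ K.IsSmall ↔ (K.sw : ℕ) + 1 < K.ne := by
  have : (K.sw : ℕ) < K.ne := K.sw_lt_ne
  rw [IsSmall]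
  omega

theorem IsSmall.eq_pred {K : Hook w} (h : K.IsSmall) : (K.sw : ℕ) = K.ne - 1 := by
  rw [IsSmall] at h
  omega

end Hook

namespace HookTuple

/-- The set of the pairs of endpoint positions of the hooks of a tuple, the encoding of
configurations used by `IsHookConfig`. -/
def pairs (H : HookTuple w) : Finset (ℕ × ℕ) :=
  univ.image fun u => (((H.2 u).sw : ℕ), ((H.2 u).ne : ℕ))

/-- The condition that the tie rule `p` imposes on the hooks that are not small. Among the binary
valid configurations, `<` selects `hooksR` and `≤` selects `hooksL`. -/
def ObeysTie (p : ℕ+ → ℕ+ → Prop) (H : HookTuple w) : Prop :=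
  ∀ u, ¬ (H.2 u).IsSmall → p (letter w (H.2 u).sw) (letter w (H.2 u).ne) ∧
    ¬ p (letter w (H.2 u).ne) (letter w ((H.2 u).ne - 1))

variable {H K : HookTuple w}

theorem mem_pairs {s e : ℕ} :
    (s, e) ∈ H.pairs ↔ ∃ u, ((H.2 u).sw : ℕ) = s ∧ ((H.2 u).ne : ℕ) = e := by
  simp [pairs]

theorem mk_mem_pairs (H : HookTuple w) (u : Fin H.1) :
    (((H.2 u).sw : ℕ), ((H.2 u).ne : ℕ)) ∈ H.pairs :=
  mem_pairs.2 ⟨u, rfl, rfl⟩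

theorem pairs_injective (hH : StrictMono fun u => (H.2 u).sw) :
    Function.Injective fun u => (((H.2 u).sw : ℕ), ((H.2 u).ne : ℕ)) :=
  fun _ _ h => hH.injective (Fin.ext (Prod.mk.inj h).1)

theorem card_pairs (hH : StrictMono fun u => (H.2 u).sw) : #H.pairs = H.1 := by
  rw [pairs, card_image_of_injective _ (pairs_injective hH), card_univ, Fintype.card_fin]

theorem eq_of_pairs_eq (hH : StrictMono fun u => (H.2 u).sw) (hK : StrictMono fun u => (K.2 u).sw)
    (h : H.pairs = K.pairs) : H = K := by
  have hcard : H.1 = K.1 := by rw [← card_pairs hH, ← card_pairs hK, h]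
  obtain ⟨k, H⟩ := H
  obtain ⟨k', K⟩ := K
  obtain rfl : k = k' := hcard
  have exists_eq {H K : Fin k → Hook w} (h : pairs ⟨k, H⟩ = pairs ⟨k, K⟩) (u : Fin k) :
      ∃ v, K v = H u := by
    obtain ⟨v, hsw, hne⟩ := mem_pairs.1 (h ▸ mk_mem_pairs ⟨k, H⟩ u)
    exact ⟨v, Hook.ext (Fin.ext hsw) (Fin.ext hne)⟩
  have hsw : (fun u => (H u).sw) = fun u => (K u).sw := by
    refine (hH.range_inj hK).1 (Set.Subset.antisymm ?_ ?_) <;> rintro _ ⟨u, rfl⟩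
    · exact (exists_eq h u).imp fun v hv => congrArg Hook.sw hv
    · exact (exists_eq h.symm u).imp fun v hv => congrArg Hook.sw hv
  congr 1
  funext u
  obtain ⟨v, hv⟩ := exists_eq h u
  have : v = u := hK.injective ((congrArg Hook.sw hv).trans (congrFun hsw u))
  rw [← hv, this]

theorem exists_pairs_eq {S : Finset (ℕ × ℕ)} (hS : IsHookConfig p (letter w) 0 w.length S) :
    ∃ H : HookTuple w, (StrictMono fun u => (H.2 u).sw) ∧ H.pairs = S := by
  let D := S.image Prod.fst
  let sw := D.orderEmbOfFin rfl
  have exists_ne (u : Fin #D) : ∃ e, (sw u, e) ∈ S := by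
    obtain ⟨⟨s, e⟩, h, h'⟩ := mem_image.1 (D.orderEmbOfFin_mem rfl u)
    exact ⟨e, by rwa [← show s = sw u from h']⟩
  choose ne mem using exists_ne
  have bounds (u : Fin #D) := hS.bounds (mem u)
  refine ⟨⟨#D, fun u => ⟨⟨sw u, (bounds u).2.1.trans (bounds u).2.2⟩, ⟨ne u, (bounds u).2.2⟩,
    (bounds u).2.1, ?_⟩⟩, fun u v huv => sw.strictMono huv, ?_⟩
  · simpa only [getElem_fin_eq_letter] using hS.letter_le (mem u)
  ext ⟨s, e⟩
  rw [mem_pairs]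
  constructor
  · rintro ⟨u, rfl, rfl⟩
    exact mem u
  · intro h
    obtain ⟨u, rfl⟩ : s ∈ Set.range sw := by
      rw [range_orderEmbOfFin]
      exact mem_image_of_mem Prod.fst h
    exact ⟨u, rfl, hS.ne_unique (mem u) h⟩

namespace IsValid

theorem sw_injective (hH : H.IsValid) {u v : Fin H.1} (h : ((H.2 u).sw : ℕ) = (H.2 v).sw) :
    u = v :=
  hH.sw_strictMono.injective (Fin.ext h)

theorem eq_of_isSmall (hH : H.IsValid) {u v : Fin H.1} (h : (H.2 u).ne = (H.2 v).ne)
    (hu : (H.2 u).IsSmall) (hv : (H.2 v).IsSmall) : u = v :=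
  hH.sw_injective (by rw [hu.eq_pred, hv.eq_pred, h])

theorem exists_small (hH : H.IsValid) (u : Fin H.1) : ∃ v, (H.2 v).IsSmall ∧
    (H.2 v).ne = (H.2 u).ne ∧ ((H.2 v).sw : ℕ) = (H.2 u).ne - 1 := by
  obtain ⟨v, hne, hv⟩ := (hH.northeast u).2
  exact ⟨v, hv, hne, hne ▸ hv.eq_pred⟩

/-- Among the hooks with a given northeast endpoint exactly one is small, so at most two hooks
means at most one that is not small. -/
theorem isBinary_iff (hH : H.IsValid) : H.IsBinary ↔
    ∀ u v, (H.2 u).ne = (H.2 v).ne → ¬ (H.2 u).IsSmall → ¬ (H.2 v).IsSmall → u = v := by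
  simp only [IsBinary, ← not_lt, Set.two_lt_ncard_iff (Set.toFinite _), Set.mem_ofPred_eq]
  constructor
  · intro h u v huv hu hv
    by_contra hne
    obtain ⟨t, ht, htne, -⟩ := hH.exists_small u
    exact h _ ⟨u, v, t, rfl, huv.symm, htne, hne, fun h => hu (h ▸ ht), fun h => hv (h ▸ ht)⟩
  · rintro h j ⟨a, b, c, ha, hb, hc, hab, hac, hbc⟩
    have h_ab := h a b (ha.trans hb.symm)
    have h_ac := h a c (ha.trans hc.symm)
    have h_bc := h b c (hb.trans hc.symm)
    have small_ab := hH.eq_of_isSmall (ha.trans hb.symm)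
    have small_ac := hH.eq_of_isSmall (ha.trans hc.symm)
    have small_bc := hH.eq_of_isSmall (hb.trans hc.symm)
    tauto

theorem isHookConfig_pairs (hH : H.IsValid) (hbin : H.IsBinary) (hp : H.ObeysTie p) :
    IsHookConfig p (letter w) 0 w.length H.pairs := by
  constructor <;> simp only [mem_pairs]
  case bounds =>
    rintro _ _ ⟨u, rfl, rfl⟩
    exact ⟨Nat.zero_le _, (H.2 u).sw_lt_ne, (H.2 u).ne.2⟩
  case letter_le =>
    rintro _ _ ⟨u, rfl, rfl⟩
    exact (H.2 u).letter_sw_le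
  case ne_unique =>
    rintro _ _ _ ⟨u, rfl, rfl⟩ ⟨v, h, rfl⟩
    rw [hH.sw_injective h]
  case exists_of_descent =>
    intro d _ hd hdesc
    obtain ⟨u, hu⟩ := hH.descent ⟨d, by omega⟩ (isDescent_iff.2 ⟨hd, hdesc⟩)
    exact ⟨_, u, congrArg Fin.val hu, rfl⟩
  case small_mem =>
    rintro _ _ ⟨u, rfl, rfl⟩
    obtain ⟨v, -, hne, hsw⟩ := hH.exists_small u
    exact ⟨v, hsw, congrArg Fin.val hne⟩
  case exists_descent =>
    rintro _ _ ⟨u, rfl, rfl⟩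
    obtain ⟨v, hne, hv⟩ := (hH.northeast u).1
    exact ⟨_, ⟨v, rfl, congrArg Fin.val hne⟩, (isDescent_iff.1 hv).2⟩
  case nested =>
    rintro _ _ _ _ ⟨u, rfl, rfl⟩ ⟨v, rfl, rfl⟩ hlt
    have := hH.nested u v
    simp only [Fin.le_def] at this
    omega
  case binary =>
    rintro _ _ _ ⟨u, rfl, rfl⟩ ⟨v, rfl, hne⟩ hu hv
    rw [hH.isBinary_iff.1 hbin u v (Fin.ext hne.symm) (Hook.not_isSmall_iff.2 hu)
      (Hook.not_isSmall_iff.2 (hne ▸ hv))]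
  case tie =>
    rintro _ _ ⟨u, rfl, rfl⟩ hu
    exact hp u (Hook.not_isSmall_iff.2 hu)

end IsValid

theorem isValid_of_isHookConfig (hsw : StrictMono fun u => (H.2 u).sw)
    (hH : IsHookConfig p (letter w) 0 w.length H.pairs) : H.IsValid where
  sw_strictMono := hsw
  descent d hd := by
    rw [isDescent_iff] at hd
    obtain ⟨e, he⟩ := hH.exists_of_descent d.1.zero_le hd.1 hd.2
    exact (mem_pairs.1 he).imp fun u hu => Fin.ext hu.1
  northeast u := by
    constructor
    · obtain ⟨d, hd, hdesc⟩ := hH.exists_descent (H.mk_mem_pairs u)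
      obtain ⟨v, rfl, hne⟩ := mem_pairs.1 hd
      have hlt : ((H.2 v).sw : ℕ) < (H.2 v).ne := (H.2 v).sw_lt_ne
      exact ⟨v, Fin.ext hne, isDescent_iff.2 ⟨by omega, hdesc⟩⟩
    · obtain ⟨v, hv, hne⟩ := mem_pairs.1 (hH.small_mem (H.mk_mem_pairs u))
      have hlt : ((H.2 v).sw : ℕ) < (H.2 v).ne := (H.2 v).sw_lt_ne
      exact ⟨v, Fin.ext hne, by rw [Hook.IsSmall]; omega⟩
  nested u v := by
    have huv := hH.nested (H.mk_mem_pairs u) (H.mk_mem_pairs v)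
    have hvu := hH.nested (H.mk_mem_pairs v) (H.mk_mem_pairs u)
    have ne_eq : ((H.2 u).sw : ℕ) = (H.2 v).sw → ((H.2 u).ne : ℕ) = (H.2 v).ne := fun h =>
      hH.ne_unique (H.mk_mem_pairs u) (h ▸ H.mk_mem_pairs v)
    simp only [Fin.le_def]
    omega

theorem isHookConfig_pairs_iff (hsw : StrictMono fun u => (H.2 u).sw) :
    IsHookConfig p (letter w) 0 w.length H.pairs ↔ H.IsValid ∧ H.IsBinary ∧ H.ObeysTie p := by
  refine ⟨fun hH => ?_, fun ⟨hH, hbin, hp⟩ => hH.isHookConfig_pairs hbin hp⟩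
  have valid := isValid_of_isHookConfig hsw hH
  refine ⟨valid, valid.isBinary_iff.2 fun u v hne hu hv => ?_, fun u hu =>
    hH.tie (H.mk_mem_pairs u) (Hook.not_isSmall_iff.1 hu)⟩
  rw [Hook.not_isSmall_iff] at hu hv
  have hv_mem := H.mk_mem_pairs v
  rw [← hne] at hv hv_mem
  exact valid.sw_injective (hH.binary (H.mk_mem_pairs u) hv_mem hu hv)

theorem sees_iff {i : Fin w.length} {u : Fin H.1} :
    H.Sees i u ↔ (((H.2 u).sw : ℕ), ((H.2 u).ne : ℕ)) ∈ seenHooks (letter w) H.pairs i := by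
  simp only [Sees, Hook.LiesAbove, mem_seenHooks, H.mk_mem_pairs u, true_and,
    getElem_fin_eq_letter, Fin.lt_def, Fin.ext_iff]

theorem forall_seenHooks_iff {i : Fin w.length} {P : ℕ × ℕ → Prop} :
    (∀ h ∈ seenHooks (letter w) H.pairs i, P h) ↔
      ∀ u, H.Sees i u → P ((H.2 u).sw, (H.2 u).ne) := by
  refine ⟨fun h u hu => h _ (sees_iff.1 hu), fun h ⟨s, e⟩ hx => ?_⟩
  obtain ⟨u, rfl, rfl⟩ := mem_pairs.1 (mem_seenHooks.1 hx).1
  exact h u (sees_iff.2 hx)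

theorem ncard_hasSkyColor (H : HookTuple w) :
    {i | H.HasSkyColor i}.ncard = skyCount (letter w) 0 w.length H.pairs := by
  rw [skyCount, ← ncard_setOf_fin]
  refine congrArg Set.ncard (Set.ext fun i => ?_)
  rw [Set.mem_ofPred_eq, Set.mem_ofPred_eq, eq_empty_iff_forall_notMem]
  exact (forall_seenHooks_iff (P := fun _ => False)).symm

theorem ncard_hasColor (H : HookTuple w) (u : Fin H.1) : {i | H.HasColor i u}.ncard =
    hookCount (letter w) 0 w.length H.pairs ((H.2 u).sw, (H.2 u).ne) := by
  rw [hookCount, ← ncard_setOf_fin]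
  refine congrArg Set.ncard (Set.ext fun i => ?_)
  exact and_congr sees_iff (forall_seenHooks_iff (P := fun h => h.1 ≤ (H.2 u).sw)).symm

theorem catalanProd_q (hH : StrictMono fun u => (H.2 u).sw) :
    catalanProd H.q = hookWeight (letter w) 0 w.length H.pairs *
      catalan (skyCount (letter w) 0 w.length H.pairs) := by
  rw [catalanProd, Fin.prod_univ_succ, mul_comm, hookWeight, pairs,
    prod_image (pairs_injective hH).injOn]
  simp only [q, Fin.cons_zero, Fin.cons_succ, ncard_hasSkyColor, ncard_hasColor, pairs]

theorem sum_catalanProd_q {s : Finset (HookTuple w)}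
    (hs : ∀ H, H ∈ s ↔ H.IsValid ∧ H.IsBinary ∧ H.ObeysTie p) :
    ∑ H ∈ s, catalanProd H.q = configSum p (letter w) 0 w.length catalan := by
  have sw_strictMono {H} (hH : H ∈ s) : StrictMono fun u => (H.2 u).sw :=
    ((hs H).1 hH).1.sw_strictMono
  refine sum_bij (fun H _ => H.pairs)
    (fun H hH => mem_configs.2 ((isHookConfig_pairs_iff (sw_strictMono hH)).2 ((hs H).1 hH)))
    (fun H hH K hK => eq_of_pairs_eq (sw_strictMono hH) (sw_strictMono hK)) (fun S hS => ?_)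
    fun H hH => catalanProd_q (sw_strictMono hH)
  obtain ⟨H, hsw, rfl⟩ := exists_pairs_eq (mem_configs.1 hS)
  exact ⟨H, (hs H).2 ((isHookConfig_pairs_iff hsw).1 (mem_configs.1 hS)), rfl⟩

theorem IsValid.letter_pred_ne_le (hH : H.IsValid) (u : Fin H.1) :
    letter w ((H.2 u).ne - 1) ≤ letter w (H.2 u).ne := by
  obtain ⟨v, -, hne, hsw⟩ := hH.exists_small u
  rw [← hsw, ← hne]
  exact (H.2 v).letter_sw_le

theorem IsValid.obeysTie_lt_iff (hH : H.IsValid) :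
    H.ObeysTie (· < ·) ↔ ∀ u, (H.2 u).IsHorizontal → (H.2 u).IsSmall := by
  refine forall_congr' fun u => ?_
  beta_reduce
  rw [and_iff_left (hH.letter_pred_ne_le u).not_gt, (H.2 u).letter_sw_le.lt_iff_ne, not_imp_comm,
    not_not, Hook.isHorizontal_iff]

theorem IsValid.obeysTie_le_iff (hH : H.IsValid) : H.ObeysTie (· ≤ ·) ↔
    ∀ u, (H.2 u).IsSmall → (H.2 u).IsHorizontal → ∀ v, v ≠ u → (H.2 v).ne ≠ (H.2 u).ne := by
  simp only [Hook.isHorizontal_iff]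
  constructor
  · intro h u hu hhor v hvu hne
    have hv : ¬ (H.2 v).IsSmall := fun hv => hvu (hH.eq_of_isSmall hne hv hu)
    refine (h v hv).2 ?_
    rw [hne, ← hu.eq_pred, hhor]
  · intro h u hu
    obtain ⟨v, hv, hne, hsw⟩ := hH.exists_small u
    refine ⟨(H.2 u).letter_sw_le, fun hle => ?_⟩
    have hhor : letter w (H.2 v).sw = letter w (H.2 v).ne := by
      rw [hsw, hne]
      exact (hH.letter_pred_ne_le u).antisymm hle
    exact h v hv hhor u (fun huv => hu (huv ▸ hv)) hne.symm

end HookTuple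

theorem sum_hooksR (w : Word) : ∑ H ∈ hooksR w, catalanProd H.q =
    configSum (· < ·) (letter w) 0 w.length catalan :=
  HookTuple.sum_catalanProd_q fun H => by
    rw [mem_hooksR]
    exact and_congr_right fun hH => and_congr_right' hH.obeysTie_lt_iff.symm

theorem sum_hooksL (w : Word) : ∑ H ∈ hooksL w, catalanProd H.q =
    configSum (· ≤ ·) (letter w) 0 w.length catalan :=
  HookTuple.sum_catalanProd_q fun H => by
    rw [mem_hooksL]
    exact and_congr_right fun hH => and_congr_right' hH.obeysTie_le_iff.symm

theorem IsPostorder.ncard_preimage {g : Word → Word} (hg : IsPostorder p g) (hp : IsTieRule p)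
    (w : Word) : (g ⁻¹' {w}).ncard = configSum p (letter w) 0 w.length catalan := by
  rw [← hg.ncard_preimage_segment hp w.length.zero_le, segment_letter]

end HookTuples

end StackSortWords

theorem mainTheorem1 (w : StackSortWords.Word) :
    ((StackSortWords.fast ⁻¹' {w}).Finite ∧
      (StackSortWords.fast ⁻¹' {w}).ncard =
        ∑ H ∈ StackSortWords.hooksR w, StackSortWords.catalanProd H.q) ∧
    ((StackSortWords.slow ⁻¹' {w}).Finite ∧
      (StackSortWords.slow ⁻¹' {w}).ncard =
        ∑ H ∈ StackSortWords.hooksL w, StackSortWords.catalanProd H.q) := by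
  rw [StackSortWords.sum_hooksR, StackSortWords.sum_hooksL]
  exact ⟨⟨StackSortWords.isPostorder_fast.finite_preimage StackSortWords.isTieRule_lt w,
      StackSortWords.isPostorder_fast.ncard_preimage StackSortWords.isTieRule_lt w⟩,
    StackSortWords.isPostorder_slow.finite_preimage StackSortWords.isTieRule_le w,
      StackSortWords.isPostorder_slow.ncard_preimage StackSortWords.isTieRule_le w⟩
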